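/- Consider the field $\mathbb{Q}$ of rational numbers with the discrete topology. Its character group is the group of all homomorphisms $y:(\mathbb{Q},+)\to\{z\in\mathbb{C}:|z|=1\}$ (a solenoid), and the characteristic function of a probability distribution $\mu$ on $\mathbb{Q}$ is the function $\hat\mu(y)=\sum_{x\in\mathbb{Q}}y(x)\,\mu(\{x\})$ on this character group. Let $a_2,a_3,b_2,b_3$ be nonzero rational numbers. Let $\xi_1,\xi_2,\xi_3,\xi_4$ be independent $\mathbb{Q}$-valued random variables with nonvanishing characteristic functions, and put $L_1=\xi_1+a_2\xi_2+a_3\xi_3$ and $L_2=b_2\xi_2+b_3\xi_3+\xi_4$. Assume that one of the following conditions holds: (I) $a_2b_3\ne a_3b_2$; (II) $a_2b_3=a_3b_2$, $|a_2|\ne|a_3|$, and $\xi_2$ and $\xi_3$ are identically distributed; (III) $a_2b_3=a_3b_2$, $a_2=a_3$, and $\xi_2$ and $\xi_3$ are identically distributed. Then the distribution of the random vector $(L_1,L_2)$ determines the distributions of $\xi_1,\xi_2,\xi_3,\xi_4$ up to shift. That is, let $\eta_1,\eta_2,\eta_3,\eta_4$ be independent $\mathbb{Q}$-valued random variables (possibly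 on another probability space) with nonvanishing characteristic functions, such that in cases (II) and (III) also $\eta_2$ and $\eta_3$ are identically distributed. If the vector $(\eta_1+a_2\eta_2+a_3\eta_3,\ b_2\eta_2+b_3\eta_3+\eta_4)$ has the same distribution as $(L_1,L_2)$, then for each $j\in\{1,2,3,4\}$ there is $c_j\in\mathbb{Q}$ such that $\eta_j$ has the same distribution as $\xi_j+c_j$. -/

import Mathlib

open MeasureTheory ProbabilityTheory

/-- The characteristic function of a distribution `μ` on the additive group of the discrete
field `ℚ`. It is a function on the whole character group of the discrete group `ℚ`
(the solenoid): a character is any homomorphism from `ℚ` to the unit circle, with no continuity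
with respect to the order topology of `ℚ`. -/
noncomputable def discreteRatCharFun (μ : Measure ℚ) (y : AddChar ℚ Circle) : ℂ :=
  ∫ x, (y x : ℂ) ∂μ

/-- The family `ξ 0, ξ 1, ξ 2, ξ 3` (written `ξ₁, ξ₂, ξ₃, ξ₄` on paper) consists of independent
random variables with values in the discrete field `ℚ` whose characteristic functions vanish
nowhere on the character group. The measurable structure of `ℚ` is the discrete one. -/
structure IsIndepNonvanishing {Ω : Type*} [MeasurableSpace Ω] (P : Measure Ω)
    (ξ : Fin 4 → Ω → ℚ) : Prop where
  measurable : ∀ j, Measurable (ξ j)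
  indep : iIndepFun ξ P
  charFun_ne_zero : ∀ j, ∀ y : AddChar ℚ Circle, discreteRatCharFun (P.map (ξ j)) y ≠ 0

/-- The random vector `(L₁, L₂)` with `L₁ = ξ₁ + a₂ ξ₂ + a₃ ξ₃` and `L₂ = b₂ ξ₂ + b₃ ξ₃ + ξ₄`,
where `ξ₁, ξ₂, ξ₃, ξ₄` are `ξ 0, ξ 1, ξ 2, ξ 3`. -/
def linearForms {Ω : Type*} (a₂ a₃ b₂ b₃ : ℚ) (ξ : Fin 4 → Ω → ℚ) (ω : Ω) : ℚ × ℚ :=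
  (ξ 0 ω + a₂ * ξ 1 ω + a₃ * ξ 2 ω, b₂ * ξ 1 ω + b₃ * ξ 2 ω + ξ 3 ω)

/-! Let `Y` be the character group of the discrete `ℚ`, a compact group and a rational vector space.
The ratios `h j` of the characteristic functions of `η j` and `ξ j` are continuous and nonvanishing
on `Y`, and independence turns equality of the laws into a multiplicative functional equation along
four linear forms in `(u, v)`. It suffices that each `h j` be evaluation at some `c : ℚ`, since this
factor is a shift by `c`.

If the forms are pairwise independent, differencing along the kernels of three of them makes the
fourth ratio a multiplicative polynomial of degree at most two
(`fwdDiff_three_eq_zero_of_sum_linearForm`). Its quadratic part is a continuous bicharacter, trivial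
by compactness and divisibility (`continuous_bicharacter_eq_one`), so the ratio is a character,
hence an evaluation (`exists_eq_ratEval`).

If the two middle forms are proportional, equal distributions give them one common ratio. After
division by a character it becomes `k` with `k w * k (r • w) = 1`, `r = a₃ / a₂`. Then `k` is
invariant under `r ^ 2`, and ergodicity makes it constant when `r ^ 2 ≠ 1`; when `r = 1`, `k` is a
continuous sign on a connected group. -/

/-! ### The compact dual of the discrete group `ℚ`: Haar measure and Fourier analysis. -/

/-- The topology of pointwise convergence on the character group of the discrete group `ℚ`. -/
noncomputable instance AddChar.ratTopology : TopologicalSpace (AddChar ℚ Circle) :=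
  TopologicalSpace.induced (fun y => (y : ℚ → Circle)) inferInstance

/-- Rational numbers act on the characters of `ℚ` by rescaling the argument. -/
noncomputable instance AddChar.ratModule : Module ℚ (AddChar ℚ Circle) where
  smul r y := y.mulShift r
  one_smul y := y.mulShift_one
  mul_smul r s y := by
    ext x
    change (y.mulShift (r * s) x : ℂ) = (y.mulShift s).mulShift r x
    simp [mul_left_comm, mul_assoc]
  smul_zero r := by ext x; rfl
  smul_add r y z := by ext x; rfl
  add_smul r s y := by
    ext x
    change (y.mulShift (r + s) x : ℂ) = y.mulShift r x * y.mulShift s x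
    simp [add_mul, AddChar.map_add_eq_mul]
  zero_smul y := y.mulShift_zero

namespace AddChar

@[simp] lemma rat_smul_apply (r : ℚ) (y : AddChar ℚ Circle) (x : ℚ) : (r • y) x = y (r * x) := rfl

lemma rat_isInducing : Topology.IsInducing (fun y : AddChar ℚ Circle => (y : ℚ → Circle)) := ⟨rfl⟩

/-- Homomorphisms are cut out of a product of circles by closed conditions, so Tychonoff yields
compactness. -/
lemma rat_isClosedEmbedding :
    Topology.IsClosedEmbedding (fun y : AddChar ℚ Circle => (y : ℚ → Circle)) := by
  refine ⟨⟨rat_isInducing, DFunLike.coe_injective⟩, ?_⟩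
  have h : Set.range (fun y : AddChar ℚ Circle => (y : ℚ → Circle)) =
      {f | f 0 = 1} ∩ ⋂ a, ⋂ b, {f | f (a + b) = f a * f b} := by
    ext f
    simp only [Set.mem_range, Set.mem_inter_iff, Set.mem_ofPred_eq, Set.mem_iInter]
    constructor
    · rintro ⟨y, rfl⟩
      exact ⟨y.map_zero_eq_one, fun a b => y.map_add_eq_mul a b⟩
    · rintro ⟨h0, hadd⟩
      exact ⟨⟨f, h0, hadd⟩, rfl⟩
  rw [h]
  refine (isClosed_eq (by fun_prop) (by fun_prop)).inter ?_
  exact isClosed_iInter fun a => isClosed_iInter fun b => isClosed_eq (by fun_prop) (by fun_prop)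

instance : CompactSpace (AddChar ℚ Circle) := rat_isClosedEmbedding.compactSpace

instance : T2Space (AddChar ℚ Circle) := rat_isClosedEmbedding.isEmbedding.t2Space

instance : SecondCountableTopology (AddChar ℚ Circle) :=
  rat_isInducing.secondCountableTopology

@[fun_prop] lemma continuous_rat_apply (x : ℚ) : Continuous fun y : AddChar ℚ Circle => y x :=
  (continuous_apply x).comp rat_isInducing.continuous

instance : IsTopologicalAddGroup (AddChar ℚ Circle) where
  continuous_add := by
    refine rat_isInducing.continuous_iff.2 (continuous_pi fun x => ?_)
    exact ((continuous_rat_apply x).comp continuous_fst).mul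
      ((continuous_rat_apply x).comp continuous_snd)
  continuous_neg := by
    refine rat_isInducing.continuous_iff.2 (continuous_pi fun x => ?_)
    exact continuous_rat_apply (-x)

instance : ContinuousConstSMul ℚ (AddChar ℚ Circle) where
  continuous_const_smul r := by
    refine rat_isInducing.continuous_iff.2 (continuous_pi fun x => ?_)
    exact continuous_rat_apply (r * x)

noncomputable instance ratMeasurableSpace : MeasurableSpace (AddChar ℚ Circle) := borel _

instance : BorelSpace (AddChar ℚ Circle) := ⟨rfl⟩

/-- The normalised Haar measure of the character group of the discrete group `ℚ`. -/
noncomputable def ratHaar : Measure (AddChar ℚ Circle) := Measure.addHaarMeasure ⊤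

instance : ratHaar.IsAddHaarMeasure := by unfold ratHaar; infer_instance

instance : IsProbabilityMeasure ratHaar := ⟨Measure.addHaarMeasure_self⟩

/-- Evaluation at a rational number, as a continuous function on the character group. -/
noncomputable def ratEval (q : ℚ) : C(AddChar ℚ Circle, ℂ) where
  toFun y := y q
  continuous_toFun := by fun_prop

@[simp] lemma ratEval_apply (q : ℚ) (y : AddChar ℚ Circle) : ratEval q y = y q := rfl

lemma ratEval_add_apply (p q : ℚ) (y : AddChar ℚ Circle) :
    ratEval (p + q) y = ratEval p y * ratEval q y := by
  simp [AddChar.map_add_eq_mul]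

lemma ratEval_add (p q : ℚ) : ratEval (p + q) = ratEval p * ratEval q := by
  ext y; exact ratEval_add_apply p q y

lemma ratEval_neg (q : ℚ) : ratEval (-q) = star (ratEval q) := by
  ext y
  change ((y (-q) : Circle) : ℂ) = (starRingEnd ℂ) (y q)
  rw [AddChar.map_neg_eq_inv, Circle.coe_inv_eq_conj]

lemma integrable_ratHaar (φ : C(AddChar ℚ Circle, ℂ)) : Integrable φ ratHaar :=
  φ.continuous.integrable_of_hasCompactSupport (HasCompactSupport.of_compactSpace _)

lemma integrable_mul_ratHaar (φ ψ : C(AddChar ℚ Circle, ℂ)) :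
    Integrable (fun y => φ y * ψ y) ratHaar := integrable_ratHaar (φ * ψ)

lemma exists_rat_apply_ne_one {q : ℚ} (hq : q ≠ 0) : ∃ y : AddChar ℚ Circle, (y q : ℂ) ≠ 1 := by
  have hq' : (q : ℝ) ≠ 0 := by exact_mod_cast hq
  refine ⟨⟨fun x => Circle.exp (Real.pi / q * x), by simp, fun a b => ?_⟩, ?_⟩
  · rw [← Circle.exp_add]; push_cast; ring_nf
  · change ((Circle.exp (Real.pi / q * q) : Circle) : ℂ) ≠ 1
    rw [div_mul_cancel₀ _ hq', Circle.coe_exp, Complex.exp_pi_mul_I]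
    norm_num

/-- A function on the character group that is multiplied by a constant other than `1` under some
translation has integral zero. -/
lemma integral_ratHaar_eq_zero_of_translate {φ : AddChar ℚ Circle → ℂ} {z : AddChar ℚ Circle}
    {c : ℂ} (hc : c ≠ 1) (h : ∀ y, φ (y + z) = c * φ y) : ∫ y, φ y ∂ratHaar = 0 := by
  have h1 := integral_add_right_eq_self (μ := ratHaar) φ z
  simp_rw [h, integral_const_mul] at h1
  have : (c - 1) * ∫ y, φ y ∂ratHaar = 0 := by linear_combination h1
  exact (mul_eq_zero.1 this).resolve_left (sub_ne_zero.2 hc)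

lemma integral_ratEval {q : ℚ} (hq : q ≠ 0) : ∫ y, ratEval q y ∂ratHaar = 0 := by
  obtain ⟨z, hz⟩ := exists_rat_apply_ne_one hq
  exact integral_ratHaar_eq_zero_of_translate hz (z := z) fun y => by simp [mul_comm]

/-- Stone–Weierstrass: evaluations are closed under products and conjugation, so their span is
already a star algebra, and they separate points. -/
lemma span_ratEval_closure_eq_top :
    (Submodule.span ℂ (Set.range ratEval)).topologicalClosure = ⊤ := by
  have hstar : Algebra.adjoin ℂ (Set.range ratEval) ≤
      star (Algebra.adjoin ℂ (Set.range ratEval)) := by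
    refine Algebra.adjoin_le ?_
    rintro - ⟨q, rfl⟩
    exact Algebra.subset_adjoin ⟨-q, ratEval_neg q⟩
  let A : StarSubalgebra ℂ C(AddChar ℚ Circle, ℂ) :=
    { toSubalgebra := Algebra.adjoin ℂ (Set.range ratEval), star_mem' := fun h => hstar h }
  have hA : Subalgebra.toSubmodule A.toSubalgebra = Submodule.span ℂ (Set.range ratEval) := by
    apply Algebra.adjoin_eq_span_of_subset
    refine Set.Subset.trans ?_ Submodule.subset_span
    intro x hx
    refine Submonoid.closure_induction (fun _ => id) ⟨0, ?_⟩ ?_ hx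
    · ext y; simp
    · rintro - - - - ⟨p, rfl⟩ ⟨q, rfl⟩
      exact ⟨p + q, ratEval_add p q⟩
  have hsep : A.SeparatesPoints := by
    intro x y hxy
    obtain ⟨q, hq⟩ := DFunLike.ne_iff.1 hxy
    refine ⟨_, ⟨ratEval q, Algebra.subset_adjoin ⟨q, rfl⟩, rfl⟩, ?_⟩
    exact fun h => hq (Circle.ext h)
  rw [← hA]
  exact congr_arg (Subalgebra.toSubmodule <| StarSubalgebra.toSubalgebra ·)
    (ContinuousMap.starSubalgebra_topologicalClosure_eq_top_of_separatesPoints A hsep)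

lemma exists_span_ratEval_close (φ : C(AddChar ℚ Circle, ℂ)) {ε : ℝ} (hε : 0 < ε) :
    ∃ ψ ∈ Submodule.span ℂ (Set.range ratEval), ∀ y, ‖φ y - ψ y‖ < ε := by
  have h : φ ∈ (Submodule.span ℂ (Set.range ratEval)).topologicalClosure := by
    rw [span_ratEval_closure_eq_top]; trivial
  obtain ⟨ψ, hψ, hd⟩ := Metric.mem_closure_iff.1 h ε hε
  refine ⟨ψ, hψ, fun y => ?_⟩
  rw [← dist_eq_norm]
  exact (ContinuousMap.dist_apply_le_dist y).trans_lt hd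

lemma norm_integral_ratHaar_le {φ : AddChar ℚ Circle → ℂ} {C : ℝ} (h : ∀ y, ‖φ y‖ ≤ C) :
    ‖∫ y, φ y ∂ratHaar‖ ≤ C := by
  simpa using norm_integral_le_of_norm_le_const (μ := ratHaar) (Filter.Eventually.of_forall h)

/-- A continuous function orthogonal to all evaluations vanishes. -/
lemma eq_zero_of_forall_integral_ratEval (φ : C(AddChar ℚ Circle, ℂ))
    (h : ∀ q, ∫ y, φ y * ratEval q y ∂ratHaar = 0) : φ = 0 := by
  have hspan : ∀ ψ ∈ Submodule.span ℂ (Set.range ratEval), ∫ y, φ y * ψ y ∂ratHaar = 0 := by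
    intro ψ hψ
    induction hψ using Submodule.span_induction with
    | mem x hx => obtain ⟨q, rfl⟩ := hx; exact h q
    | zero => simp
    | add x y _ _ hx hy =>
      simp only [ContinuousMap.add_apply, mul_add]
      rw [integral_add (integrable_mul_ratHaar φ x) (integrable_mul_ratHaar φ y), hx, hy, add_zero]
    | smul a x _ hx =>
      simp only [ContinuousMap.smul_apply, smul_eq_mul, mul_left_comm _ a]
      rw [integral_const_mul, hx, mul_zero]
  have hzero : ∫ y, φ y * star φ y ∂ratHaar = 0 := by
    by_contra hne
    have hpos := norm_pos_iff.2 hne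
    set δ := ‖∫ y, φ y * star φ y ∂ratHaar‖
    -- The tolerance yields `δ ≤ δ / 2`; the `+ 1` guards against `‖φ‖ = 0`.
    obtain ⟨ψ, hψ, hd⟩ := exists_span_ratEval_close (star φ) (ε := δ / (2 * (‖φ‖ + 1)))
      (by positivity)
    have h1 : ∫ y, φ y * star φ y ∂ratHaar = ∫ y, φ y * (star φ y - ψ y) ∂ratHaar := by
      simp only [mul_sub]
      rw [integral_sub (integrable_mul_ratHaar φ (star φ)) (integrable_mul_ratHaar φ ψ), hspan ψ hψ,
        sub_zero]
    have h2 : δ ≤ (‖φ‖ + 1) * (δ / (2 * (‖φ‖ + 1))) := by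
      change ‖_‖ ≤ _
      rw [h1]
      refine norm_integral_ratHaar_le fun y => ?_
      rw [norm_mul]
      exact mul_le_mul ((φ.norm_coe_le_norm y).trans (by linarith)) (hd y).le (norm_nonneg _)
        (by positivity)
    have h3 : (‖φ‖ + 1) * (δ / (2 * (‖φ‖ + 1))) = δ / 2 := by field_simp
    linarith
  have hsq : ∫ y, ‖φ y‖ ^ 2 ∂ratHaar = 0 := by
    have : ∀ y, φ y * star φ y = ((‖φ y‖ ^ 2 : ℝ) : ℂ) := fun y => by
      simp [Complex.mul_conj']
    simp_rw [this] at hzero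
    rw [integral_complex_ofReal] at hzero
    exact_mod_cast hzero
  have hcont : Continuous fun y => ‖φ y‖ ^ 2 := by fun_prop
  have hae := (integral_eq_zero_iff_of_nonneg (fun y => by positivity)
    (hcont.integrable_of_hasCompactSupport (HasCompactSupport.of_compactSpace _))).1 hsq
  have := (Continuous.ae_eq_iff_eq ratHaar hcont continuous_const).1 hae
  ext y
  have hy : ‖φ y‖ ^ 2 = 0 := congrFun this y
  simpa using hy

end AddChar

/-! ### Continuous bicharacters and signs on compact divisible groups. -/

open Filter Topology

/-- No small subgroups: near `1`, squaring multiplies the distance to `1` by `|w + 1| ≥ 3 / 2`. -/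
lemma Complex.eq_one_of_forall_norm_pow_sub_one_le {z : ℂ} (h : ∀ n : ℕ, ‖z ^ n - 1‖ ≤ 1 / 2) :
    z = 1 := by
  have hgrow : ∀ n : ℕ, (3 / 2 : ℝ) ^ n * ‖z - 1‖ ≤ ‖z ^ 2 ^ n - 1‖ := by
    intro n
    induction n with
    | zero => simp
    | succ n ih =>
      have h1 : z ^ 2 ^ (n + 1) - 1 = (2 + (z ^ 2 ^ n - 1)) * (z ^ 2 ^ n - 1) := by ring
      have h2 : (3 / 2 : ℝ) ≤ ‖2 + (z ^ 2 ^ n - 1)‖ := by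
        have h3 := norm_sub_le (2 + (z ^ 2 ^ n - 1)) (z ^ 2 ^ n - 1)
        rw [add_sub_cancel_right, Complex.norm_ofNat] at h3
        linarith [h (2 ^ n)]
      rw [h1, norm_mul, pow_succ', mul_assoc]
      exact mul_le_mul h2 ih (by positivity) (norm_nonneg _)
  by_contra hz
  have hpos : 0 < ‖z - 1‖ := norm_pos_iff.2 (sub_ne_zero.2 hz)
  obtain ⟨n, hn⟩ := pow_unbounded_of_one_lt (1 / ‖z - 1‖) (by norm_num : (1 : ℝ) < 3 / 2)
  rw [div_lt_iff₀ hpos] at hn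
  linarith [hgrow n, h (2 ^ n)]

section CompactModule

variable {Y : Type*} [AddCommGroup Y] [Module ℚ Y] [TopologicalSpace Y] [IsTopologicalAddGroup Y]
  [CompactSpace Y]

/-- An open subgroup of a compact divisible group is the whole group. -/
lemma AddSubgroup.eq_top_of_mem_nhds_of_compact_rat (V : AddSubgroup Y) (hV : (V : Set Y) ∈ 𝓝 0) :
    V = ⊤ := by
  have hopen : IsOpen (V : Set Y) := V.isOpen_of_mem_nhds hV
  have hfin : Finite (Y ⧸ V) := V.quotient_finite_of_isOpen hopen
  have hidx : V.index ≠ 0 := (AddSubgroup.finiteIndex_of_finite_quotient (H := V)).index_ne_zero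
  refine eq_top_iff.2 fun y _ => ?_
  -- Multiplication by the finite index maps into `V`, yet is onto by divisibility.
  have h := V.nsmul_index_mem ((V.index : ℚ)⁻¹ • y)
  rwa [← Nat.cast_smul_eq_nsmul ℚ, smul_smul, mul_inv_cancel₀ (by exact_mod_cast hidx),
    one_smul] at h

/-- A continuous bicharacter on a compact divisible group is trivial. -/
lemma continuous_bicharacter_eq_one {B : Y → Y → ℂ} (hB : Continuous fun p : Y × Y => B p.1 p.2)
    (hne : ∀ k l, B k l ≠ 0)
    (hadd : ∀ k k' l, B (k + k') l = B k l * B k' l) (hsymm : ∀ k l, B k l = B l k) (k l : Y) :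
    B k l = 1 := by
  have hzero : ∀ l, B 0 l = 1 := fun l => by
    have h := hadd 0 0 l
    rw [add_zero] at h
    exact (mul_eq_left₀ (hne 0 l)).1 h.symm
  have hpow : ∀ k l, ∀ n : ℕ, B k (n • l) = B k l ^ n := by
    intro k l n
    induction n with
    | zero => rw [zero_smul, hsymm, hzero, pow_zero]
    | succ n ih => rw [succ_nsmul, hsymm, hadd, hsymm, ih, hsymm l, pow_succ]
  let V : AddSubgroup Y :=
    { carrier := {k | ∀ l, B k l = 1}
      add_mem' := fun {a b} ha hb l => by rw [hadd, ha l, hb l, one_mul]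
      zero_mem' := hzero
      neg_mem' := fun {a} ha l => by
        have h := hadd a (-a) l
        rw [add_neg_cancel, hzero, ha l, one_mul] at h
        exact h.symm }
  -- By compactness, `B k l` is near `1` uniformly in `l` for small `k`; replacing `l` by `n • l`
  -- covers all powers.
  have hV : (V : Set Y) ∈ 𝓝 0 := by
    have hev : ∀ᶠ k in 𝓝 (0 : Y), ∀ l ∈ (Set.univ : Set Y), ‖B k l - 1‖ < 1 / 2 := by
      refine isCompact_univ.eventually_forall_of_forall_eventually fun l _ => ?_
      have hc : Continuous fun p : Y × Y => ‖B p.1 p.2 - 1‖ := by fun_prop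
      exact hc.continuousAt.eventually_lt continuousAt_const (by simp [hzero])
    filter_upwards [hev] with k hk
    intro l
    refine Complex.eq_one_of_forall_norm_pow_sub_one_le fun n => ?_
    rw [← hpow]
    exact (hk _ trivial).le
  have htop := V.eq_top_of_mem_nhds_of_compact_rat hV
  have hk : k ∈ V := htop ▸ trivial
  exact hk l

/-- A compact divisible group is connected: a continuous sign on it is constant. -/
lemma eq_one_of_sq_eq_one_of_continuous {e : Y → ℂ} (he : Continuous e) (h0 : e 0 = 1)
    (hsq : ∀ y, e y ^ 2 = 1) (y : Y) : e y = 1 := by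
  let V : AddSubgroup Y :=
    { carrier := {k | ∀ y, e (y + k) = e y}
      add_mem' := fun {a b} ha hb y => by rw [← add_assoc, hb, ha]
      zero_mem' := fun y => by rw [add_zero]
      neg_mem' := fun {a} ha y => by rw [← ha (y + -a), neg_add_cancel_right] }
  -- The periods of `e` contain a neighbourhood of `0`, as values `±1` closer than `1` coincide.
  have hV : (V : Set Y) ∈ 𝓝 0 := by
    have hev : ∀ᶠ k in 𝓝 (0 : Y), ∀ y ∈ (Set.univ : Set Y), ‖e (y + k) - e y‖ < 1 := by
      refine isCompact_univ.eventually_forall_of_forall_eventually fun y _ => ?_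
      have hc : Continuous fun p : Y × Y => ‖e (p.2 + p.1) - e p.2‖ := by fun_prop
      exact hc.continuousAt.eventually_lt continuousAt_const (by simp)
    filter_upwards [hev] with k hk
    intro y
    have hlt := hk y trivial
    rcases sq_eq_one_iff.1 (hsq y) with h | h <;>
    rcases sq_eq_one_iff.1 (hsq (y + k)) with h' | h' <;>
    · rw [h, h'] at hlt ⊢
      try norm_num at hlt
  have htop := V.eq_top_of_mem_nhds_of_compact_rat hV
  have hk : y ∈ V := htop ▸ trivial
  rw [← h0, ← hk 0, zero_add]

end CompactModule

/-! ### Continuous characters of the dual, and ergodicity of rescaling. -/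

namespace AddChar

/-- Continuous characters of the character group of the discrete group `ℚ` are evaluations. -/
lemma exists_eq_ratEval {h : AddChar ℚ Circle → ℂ} (hc : Continuous h) (h0 : h 0 ≠ 0)
    (hadd : ∀ y z, h (y + z) = h y * h z) : ∃ c : ℚ, ∀ y, h y = y c := by
  by_contra! hcon
  -- If `h` is no evaluation, its product with any evaluation is a nontrivial character and
  -- integrates to zero.
  have hzero := eq_zero_of_forall_integral_ratEval ⟨h, hc⟩ fun q => by
    obtain ⟨z, hz⟩ := hcon (-q)
    refine integral_ratHaar_eq_zero_of_translate (z := z) (c := h z * z q) (fun hone => hz ?_) ?_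
    · rw [AddChar.map_neg_eq_inv, Circle.coe_inv]
      exact eq_inv_of_mul_eq_one_left hone
    · intro y
      simp [hadd]
      ring
  exact h0 (congrArg (fun φ : C(AddChar ℚ Circle, ℂ) => φ 0) hzero)

lemma map_smul_ratHaar {s : ℚ} (hs : s ≠ 0) : ratHaar.map (fun y => s • y) = ratHaar := by
  have hcont : Continuous fun y : AddChar ℚ Circle => s • y := continuous_const_smul s
  let e : AddChar ℚ Circle ≃+ AddChar ℚ Circle := DistribMulAction.toAddEquiv₀ _ s hs
  have : (ratHaar.map e).IsAddHaarMeasure :=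
    e.isAddHaarMeasure_map ratHaar hcont (continuous_const_smul s⁻¹)
  have : IsProbabilityMeasure (ratHaar.map e) :=
    Measure.isProbabilityMeasure_map hcont.measurable.aemeasurable
  exact Measure.isAddHaarMeasure_eq_of_isProbabilityMeasure (ratHaar.map e) ratHaar

/-- Fourier coefficients along an injective sequence tend to zero. -/
lemma tendsto_integral_mul_ratEval (φ : C(AddChar ℚ Circle, ℂ)) {u : ℕ → ℚ}
    (hu : Function.Injective u) :
    Tendsto (fun n => ∫ y, φ y * ratEval (u n) y ∂ratHaar) atTop (𝓝 0) := by
  have hspan : ∀ ψ ∈ Submodule.span ℂ (Set.range ratEval),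
      ∀ᶠ n in atTop, ∫ y, ψ y * ratEval (u n) y ∂ratHaar = 0 := by
    intro ψ hψ
    induction hψ using Submodule.span_induction with
    | mem x hx =>
      obtain ⟨q, rfl⟩ := hx
      have hev : ∀ᶠ n in atTop, u n ≠ -q := by
        rw [← Nat.cofinite_eq_atTop]
        exact hu.tendsto_cofinite.eventually (eventually_cofinite_ne _)
      filter_upwards [hev] with n hn
      simp only [← ratEval_add_apply]
      exact integral_ratEval fun h => hn (by linarith)
    | zero => simp
    | add x y _ _ hx hy =>
      filter_upwards [hx, hy] with n hx hy
      simp only [ContinuousMap.add_apply, add_mul]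
      rw [integral_add (integrable_mul_ratHaar x _) (integrable_mul_ratHaar y _), hx, hy, add_zero]
    | smul a x _ hx =>
      filter_upwards [hx] with n hx
      simp only [ContinuousMap.smul_apply, smul_eq_mul, mul_assoc]
      rw [integral_const_mul, hx, mul_zero]
  rw [Metric.tendsto_atTop']
  intro ε hε
  obtain ⟨ψ, hψ, hd⟩ := exists_span_ratEval_close φ (half_pos hε)
  obtain ⟨N, hN⟩ := eventually_atTop.1 (hspan ψ hψ)
  refine ⟨N, fun n hn => ?_⟩
  have h1 : ∫ y, φ y * ratEval (u n) y ∂ratHaar = ∫ y, (φ y - ψ y) * ratEval (u n) y ∂ratHaar := by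
    simp only [sub_mul]
    rw [integral_sub (integrable_mul_ratHaar φ _) (integrable_mul_ratHaar ψ _), hN n hn.le, sub_zero]
  rw [dist_zero_right, h1]
  refine (norm_integral_ratHaar_le (C := ε / 2) fun y => ?_).trans_lt (half_lt_self hε)
  rw [norm_mul, ratEval_apply, Circle.norm_coe, mul_one]
  exact (hd y).le

/-- Ergodicity of the rescaling by a rational number that is not a root of unity. -/
lemma eq_of_forall_smul_eq {h : AddChar ℚ Circle → ℂ} (hc : Continuous h) {s : ℚ} (hs : 0 < s)
    (hs1 : s ≠ 1) (hinv : ∀ y, h (s • y) = h y) (y : AddChar ℚ Circle) : h y = h 0 := by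
  let φ : C(AddChar ℚ Circle, ℂ) := ⟨h, hc⟩
  have hstep : ∀ q, ∫ y, φ y * ratEval (s * q) y ∂ratHaar = ∫ y, φ y * ratEval q y ∂ratHaar := by
    intro q
    conv_rhs => rw [← map_smul_ratHaar hs.ne']
    refine Eq.trans ?_ (integral_map (continuous_const_smul s).measurable.aemeasurable
      (φ.continuous.mul (ratEval q).continuous).aestronglyMeasurable).symm
    refine integral_congr_ae (Eventually.of_forall fun y => ?_)
    change h y * y (s * q) = h (s • y) * y (s * q)
    rw [hinv]
  have hiter : ∀ q, ∀ n : ℕ,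
      ∫ y, φ y * ratEval (s ^ n * q) y ∂ratHaar = ∫ y, φ y * ratEval q y ∂ratHaar := by
    intro q n
    induction n with
    | zero => simp
    | succ n ih => rw [pow_succ', mul_assoc, hstep, ih]
  -- The coefficients are constant along the infinite orbit `s ^ n * q`, but tend to zero there.
  have hcoef : ∀ q ≠ 0, ∫ y, φ y * ratEval q y ∂ratHaar = 0 := by
    intro q hq
    have hu : Function.Injective fun n : ℕ => s ^ n * q :=
      (mul_left_injective₀ hq).comp (pow_right_injective₀ hs hs1)
    have ht := tendsto_integral_mul_ratEval φ hu
    simp only [hiter] at ht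
    exact tendsto_nhds_unique tendsto_const_nhds ht
  set m := ∫ y, φ y ∂ratHaar with hm
  have hzero := eq_zero_of_forall_integral_ratEval (φ - ContinuousMap.const _ m) fun q => by
    simp only [ContinuousMap.sub_apply, ContinuousMap.const_apply, sub_mul]
    rw [integral_sub (integrable_mul_ratHaar φ _) ((integrable_ratHaar _).const_mul m),
      integral_const_mul]
    rcases eq_or_ne q 0 with rfl | hq
    · simp [hm]
    · rw [hcoef q hq, integral_ratEval hq, mul_zero, sub_zero]
  have hval : ∀ y, h y = m := fun y =>
    sub_eq_zero.1 (congrArg (fun φ : C(AddChar ℚ Circle, ℂ) => φ y) hzero)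
  rw [hval, hval]

end AddChar

/-! ### Fourier inversion and uniqueness for characteristic functions. -/

section CharFun

variable (μ ν : Measure ℚ)

lemma measurable_uncurry_ratEval :
    Measurable fun p : AddChar ℚ Circle × ℚ => (p.1 p.2 : ℂ) :=
  measurable_from_prod_countable_left fun q => (AddChar.ratEval q).continuous.measurable

lemma integrable_ratChar [IsFiniteMeasure μ] (y : AddChar ℚ Circle) :
    Integrable (fun x => (y x : ℂ)) μ :=
  (integrable_const (1 : ℝ)).mono' (measurable_of_countable _).aestronglyMeasurable
    (Eventually.of_forall fun _ => (Circle.norm_coe _).le)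

lemma continuous_discreteRatCharFun [IsFiniteMeasure μ] : Continuous (discreteRatCharFun μ) := by
  refine continuous_of_dominated (bound := fun _ => 1)
    (fun y => (integrable_ratChar μ y).aestronglyMeasurable)
    (fun y => Eventually.of_forall fun x => (Circle.norm_coe _).le) (integrable_const _)
    (Eventually.of_forall fun x => (AddChar.ratEval x).continuous)

lemma discreteRatCharFun_zero [IsProbabilityMeasure μ] : discreteRatCharFun μ 0 = 1 := by
  simp [discreteRatCharFun]

lemma integral_discreteRatCharFun_mul [IsFiniteMeasure μ] (x : ℚ) :
    ∫ y, discreteRatCharFun μ y * AddChar.ratEval (-x) y ∂AddChar.ratHaar = μ.real {x} := by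
  have h1 : ∀ y, discreteRatCharFun μ y * AddChar.ratEval (-x) y =
      ∫ q, AddChar.ratEval (q - x) y ∂μ := fun y => by
    rw [discreteRatCharFun, ← integral_mul_const]
    simp only [sub_eq_add_neg, AddChar.ratEval_add_apply]
    rfl
  have hmeas : Measurable fun p : AddChar ℚ Circle × ℚ => AddChar.ratEval (p.2 - x) p.1 :=
    measurable_uncurry_ratEval.comp
      (measurable_fst.prodMk ((measurable_of_countable fun q : ℚ => q - x).comp measurable_snd))
  simp_rw [h1]
  rw [integral_integral_swap]
  · have h2 : ∀ q, ∫ y, AddChar.ratEval (q - x) y ∂AddChar.ratHaar =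
        ({x} : Set ℚ).indicator (fun _ => (1 : ℂ)) q := by
      intro q
      rcases eq_or_ne q x with rfl | hq
      · simp
      · rw [AddChar.integral_ratEval (sub_ne_zero.2 hq), Set.indicator_of_notMem (by simpa using hq)]
    simp_rw [h2]
    rw [integral_indicator (measurableSet_singleton x)]
    simp [Measure.real]
  · refine (integrable_const (1 : ℝ)).mono' hmeas.aestronglyMeasurable
      (Eventually.of_forall fun p => (Circle.norm_coe _).le)

/-- A distribution on the discrete group `ℚ` is determined by its characteristic function. -/
lemma eq_of_discreteRatCharFun_eq [IsFiniteMeasure μ] [IsFiniteMeasure ν]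
    (h : ∀ y, discreteRatCharFun μ y = discreteRatCharFun ν y) : μ = ν := by
  refine Measure.ext_of_singleton fun x => ?_
  have h1 := integral_discreteRatCharFun_mul μ x
  simp_rw [h, integral_discreteRatCharFun_mul ν x] at h1
  have h2 : ν.real {x} = μ.real {x} := by exact_mod_cast h1
  exact ((measureReal_eq_measureReal_iff).1 h2).symm

lemma eq_map_add_of_discreteRatCharFun_eq [IsFiniteMeasure μ] [IsFiniteMeasure ν] (c : ℚ)
    (h : ∀ y, discreteRatCharFun ν y = discreteRatCharFun μ y * y c) :
    ν = μ.map (fun x => x + c) := by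
  have hm : Measurable fun x : ℚ => x + c := measurable_of_countable _
  refine eq_of_discreteRatCharFun_eq _ _ fun y => ?_
  rw [h, discreteRatCharFun, discreteRatCharFun, integral_map hm.aemeasurable
    (measurable_of_countable _).aestronglyMeasurable, ← integral_mul_const]
  simp [AddChar.map_add_eq_mul]

end CharFun

/-! ### Functional equations along linear forms, by finite differences. -/

section Elimination

variable {Y A : Type*} [AddCommGroup Y] [AddCommGroup A]

lemma fwdDiff_zero_right (k : Y) : fwdDiff k (0 : Y → A) = 0 := by
  ext y; simp [fwdDiff]

lemma fwdDiff_zero_step (F : Y → A) : fwdDiff 0 F = 0 := by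
  ext y; simp [fwdDiff]

variable [Module ℚ Y]

/-- Differencing a functional equation along the kernel of its `j`-th linear form. -/
lemma sum_fwdDiff_linearForm_eq_zero {ι : Type*} [Fintype ι] {α β : ι → ℚ} {F : ι → Y → A}
    (h : ∀ u v, ∑ i, F i (α i • u + β i • v) = 0) (j : ι) (k u v : Y) :
    ∑ i, fwdDiff ((α i * β j - β i * α j) • k) (F i) (α i • u + β i • v) = 0 := by
  -- This shift lies in the kernel of the `j`-th form, so the `j`-th term gets step zero and drops
  -- out.
  have h1 := h (u + β j • k) (v + -(α j) • k)
  have h2 := h u v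
  simp only [fwdDiff, Finset.sum_sub_distrib, h2, sub_zero]
  rw [← h1]
  refine Finset.sum_congr rfl fun i _ => congrArg (F i) ?_
  module

/-- If four pairwise independent linear forms in two variables satisfy a functional equation, each
of the functions is a polynomial of degree at most two. -/
lemma fwdDiff_three_eq_zero_of_sum_linearForm {α β : Fin 4 → ℚ} {F : Fin 4 → Y → A}
    (hdet : ∀ i j, i ≠ j → α i * β j - β i * α j ≠ 0)
    (h : ∀ u v, ∑ i, F i (α i • u + β i • v) = 0) (i : Fin 4) (k l m y : Y) :
    fwdDiff k (fwdDiff l (fwdDiff m (F i))) y = 0 := by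
  have hidx : ∀ i : Fin 4, ∃ a b c, i ≠ a ∧ i ≠ b ∧ i ≠ c ∧ ∀ n, n ≠ i → n = a ∨ n = b ∨ n = c := by
    decide
  obtain ⟨a, b, c, ha, hb, hc, hall⟩ := hidx i
  have hscale : ∀ {q : ℚ} (z : Y), q ≠ 0 → q • q⁻¹ • z = z := fun z hq => by
    rw [smul_smul, mul_inv_cancel₀ hq, one_smul]
  have hsurj : ∃ u v : Y, α i • u + β i • v = y := by
    by_cases hα : α i = 0
    · have hβ : β i ≠ 0 := fun hβ => hdet i a ha (by simp [hα, hβ])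
      exact ⟨0, (β i)⁻¹ • y, by rw [hscale _ hβ, smul_zero, zero_add]⟩
    · exact ⟨(α i)⁻¹ • y, 0, by rw [hscale _ hα, smul_zero, add_zero]⟩
  obtain ⟨u, v, rfl⟩ := hsurj
  -- Inverse determinants make the steps acting on `F i` exactly `m`, `l`, `k`.
  have h1 := sum_fwdDiff_linearForm_eq_zero h a ((α i * β a - β i * α a)⁻¹ • m)
  have h2 := sum_fwdDiff_linearForm_eq_zero h1 b ((α i * β b - β i * α b)⁻¹ • l)
  have h3 := sum_fwdDiff_linearForm_eq_zero h2 c ((α i * β c - β i * α c)⁻¹ • k) u v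
  rw [Finset.sum_eq_single i _ (by simp)] at h3
  · rwa [hscale _ (hdet i a ha), hscale _ (hdet i b hb), hscale _ (hdet i c hc)] at h3
  · intro n _ hn
    have hself : ∀ n, α n * β n - β n * α n = 0 := fun n => by ring
    rcases hall n hn with rfl | rfl | rfl <;>
      simp [hself, fwdDiff_zero_step, fwdDiff_zero_right]

end Elimination

section CompactModule

variable {Y : Type*} [AddCommGroup Y] [Module ℚ Y] [TopologicalSpace Y] [IsTopologicalAddGroup Y]
  [CompactSpace Y]

/-- On a compact divisible group a continuous multiplicative polynomial of degree at most two,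
normalised at the origin, is a character. -/
lemma map_add_eq_mul_of_fwdDiff_three {h : Y → ℂˣ} (hc : Continuous fun y => (h y : ℂ))
    (h0 : h 0 = 1)
    (hdiff : ∀ k l m y, fwdDiff k (fwdDiff l (fwdDiff m fun y => Additive.ofMul (h y))) y = 0)
    (k l : Y) : h (k + l) = h k * h l := by
  -- `B` is the defect of multiplicativity; the vanishing third difference at `0` makes it a
  -- bicharacter.
  let B : Y → Y → ℂˣ := fun k l => h (k + l) * (h k)⁻¹ * (h l)⁻¹
  have hB : ∀ k l, (B k l : ℂ) = 1 := by
    refine continuous_bicharacter_eq_one (B := fun k l => (B k l : ℂ)) ?_ (fun _ _ => Units.ne_zero _)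
      (fun k k' l => ?_) (fun k l => ?_)
    · simp only [B, Units.val_mul, Units.val_inv_eq_inv_val]
      have hi : Continuous fun y => (h y : ℂ)⁻¹ := hc.inv₀ fun y => (h y).ne_zero
      exact ((hc.comp continuous_add).mul (hi.comp continuous_fst)).mul (hi.comp continuous_snd)
    · have h1 := congrArg Additive.toMul (hdiff k k' l 0)
      simp only [fwdDiff, zero_add, h0, toMul_sub, toMul_ofMul, toMul_zero, div_one] at h1
      rw [div_eq_one, div_eq_iff_eq_mul, div_eq_iff_eq_mul] at h1
      rw [← Units.val_mul]
      congr 1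
      simp only [B, h1, div_eq_mul_inv]
      have hcancel : ∀ x a b c d e : ℂˣ,
          a * b⁻¹ * c⁻¹ * (d * e⁻¹) * x * x⁻¹ * c⁻¹ = d * e⁻¹ * c⁻¹ * (a * b⁻¹ * c⁻¹) :=
        fun x a b c d e => by rw [mul_inv_cancel_right, mul_comm _ (d * e⁻¹), mul_right_comm]
      exact hcancel _ _ _ _ _ _
    · simp only [B, add_comm l k]
      push_cast
      ring
  have h1 : h (k + l) * (h k)⁻¹ * (h l)⁻¹ = 1 := Units.ext (hB k l)
  rw [mul_assoc, ← mul_inv_rev, mul_inv_eq_one] at h1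
  rw [h1, mul_comm]

end CompactModule

namespace AddChar

/-- The functional equation for four pairwise independent linear forms on the character group of
the discrete group `ℚ` has only characters as normalised continuous solutions. -/
lemma exists_eq_ratEval_of_prod_linearForm {α β : Fin 4 → ℚ} {h : Fin 4 → AddChar ℚ Circle → ℂ}
    (hdet : ∀ i j, i ≠ j → α i * β j - β i * α j ≠ 0) (hc : ∀ i, Continuous (h i))
    (hne : ∀ i y, h i y ≠ 0) (h0 : ∀ i, h i 0 = 1)
    (heq : ∀ u v, ∏ i, h i (α i • u + β i • v) = 1) (i : Fin 4) :
    ∃ c : ℚ, ∀ y, h i y = y c := by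
  let H : Fin 4 → AddChar ℚ Circle → ℂˣ := fun i y => Units.mk0 (h i y) (hne i y)
  have hsum : ∀ u v, ∑ i, Additive.ofMul (H i (α i • u + β i • v)) = 0 := by
    intro u v
    rw [← ofMul_prod, ← ofMul_one]
    refine congrArg Additive.ofMul (Units.ext ?_)
    rw [Units.coe_prod]
    exact heq u v
  have hdiff := fwdDiff_three_eq_zero_of_sum_linearForm
    (F := fun i y => Additive.ofMul (H i y)) hdet hsum i
  have hmul := map_add_eq_mul_of_fwdDiff_three (h := H i) (hc i) (Units.ext (h0 i)) hdiff
  exact exists_eq_ratEval (hc i) (hne i 0) fun y z => congrArg Units.val (hmul y z)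

end AddChar

/-! ### From the law of the linear forms to the ratios. -/

section LinearForms

variable {Ω : Type*} [MeasurableSpace Ω] {P : Measure Ω} {ξ : Fin 4 → Ω → ℚ}

lemma measurable_linearForms (a₂ a₃ b₂ b₃ : ℚ) (hξ : ∀ j, Measurable (ξ j)) :
    Measurable (linearForms a₂ a₃ b₂ b₃ ξ) := by
  have h0 := hξ 0
  have h1 := hξ 1
  have h2 := hξ 2
  have h3 := hξ 3
  unfold linearForms
  fun_prop

/-- The characteristic function of the vector of linear forms, by independence. -/
lemma integral_map_linearForms (a₂ a₃ b₂ b₃ : ℚ) (hξ : IsIndepNonvanishing P ξ)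
    (u v : AddChar ℚ Circle) :
    ∫ p, ((u p.1 * v p.2 : Circle) : ℂ) ∂P.map (linearForms a₂ a₃ b₂ b₃ ξ) =
      ∏ i, discreteRatCharFun (P.map (ξ i)) (![1, a₂, a₃, 0] i • u + ![0, b₂, b₃, 1] i • v) := by
  rw [integral_map (measurable_linearForms a₂ a₃ b₂ b₃ hξ.measurable).aemeasurable
    (measurable_of_countable _).aestronglyMeasurable]
  simp only [discreteRatCharFun]
  have hint : ∀ i, ∀ y : AddChar ℚ Circle, ∫ x, (y x : ℂ) ∂P.map (ξ i) = ∫ ω, (y (ξ i ω) : ℂ) ∂P :=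
    fun i y => integral_map (hξ.measurable i).aemeasurable
      (measurable_of_countable _).aestronglyMeasurable
  simp_rw [hint]
  rw [← hξ.indep.integral_fun_prod_comp
    (f := fun i x => (((![1, a₂, a₃, 0] i • u + ![0, b₂, b₃, 1] i • v) x : Circle) : ℂ))
    (fun i => (hξ.measurable i).aemeasurable)
    (fun i => (measurable_of_countable _).aestronglyMeasurable)]
  refine integral_congr_ae (Filter.Eventually.of_forall fun ω => ?_)
  simp only [linearForms, Fin.prod_univ_four, AddChar.map_add_eq_mul, AddChar.add_apply,
    AddChar.rat_smul_apply, Circle.coe_mul]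
  simp
  ring

end LinearForms

namespace AddChar

/-- The functional equation for proportional linear forms with equal coefficient functions. -/
lemma exists_eq_ratEval_of_mul_linearForm {h₀ h h₃ : AddChar ℚ Circle → ℂ} {a₂ a₃ t : ℚ}
    (hsum : a₂ + a₃ ≠ 0) (ht : t ≠ 0) (hc : Continuous h)
    (h₀0 : h₀ 0 = 1) (h0 : h 0 = 1) (h₃0 : h₃ 0 = 1)
    (heq : ∀ u v, h₀ u * h (a₂ • (u + t • v)) * h (a₃ • (u + t • v)) * h₃ v = 1) :
    (∃ c : ℚ, ∀ y, h₀ y = y c) ∧ (∃ c : ℚ, ∀ y, h₃ y = y c) ∧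
      ∃ c : ℚ, ∀ w, (h (a₂ • w) * (a₂ • w) (-c)) * (h (a₃ • w) * (a₃ • w) (-c)) = 1 := by
  let H : AddChar ℚ Circle → ℂ := fun w => h (a₂ • w) * h (a₃ • w)
  have hH : ∀ u v, h₀ u * H (u + t • v) * h₃ v = 1 := fun u v => by
    rw [← heq u v]; simp only [H]; ring
  have hH0 : H 0 = 1 := by simp [H, h0]
  have hl : ∀ u, h₀ u * H u = 1 := fun u => by simpa [h₃0] using hH u 0
  have hr : ∀ v, H (t • v) * h₃ v = 1 := fun v => by simpa [h₀0] using hH 0 v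
  have hadd : ∀ u w, H (u + w) = H u * H w := by
    intro u w
    have h1 := hH u (t⁻¹ • w)
    have h2 := hr (t⁻¹ • w)
    rw [smul_smul, mul_inv_cancel₀ ht, one_smul] at h1 h2
    linear_combination (-H (u + w) * (h₀ u * H u)) * h2 - H (u + w) * hl u + H u * H w * h1
  have hHc : Continuous H :=
    (hc.comp (continuous_const_smul a₂)).mul (hc.comp (continuous_const_smul a₃))
  obtain ⟨c, hcH⟩ := exists_eq_ratEval hHc (by rw [hH0]; exact one_ne_zero) hadd
  -- Here `h₀` and `h₃` are inverses of `H u` and `H (t • v)`. Evaluations at `c / (a₂ + a₃)` of `a₂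
  -- • w` and `a₃ • w` multiply to `w c`, which cancels `H`.
  refine ⟨⟨-c, fun y => ?_⟩, ⟨-(t * c), fun y => ?_⟩, ⟨c / (a₂ + a₃), fun w => ?_⟩⟩
  · rw [AddChar.map_neg_eq_inv, Circle.coe_inv, ← hcH]
    exact eq_inv_of_mul_eq_one_left (hl y)
  · rw [AddChar.map_neg_eq_inv, Circle.coe_inv, ← rat_smul_apply, ← hcH]
    exact eq_inv_of_mul_eq_one_right (hr y)
  · have h1 : (w (a₂ * -(c / (a₂ + a₃))) : ℂ) * w (a₃ * -(c / (a₂ + a₃))) = (w c : ℂ)⁻¹ := by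
      rw [← Circle.coe_mul, ← AddChar.map_add_eq_mul, ← Circle.coe_inv, ← AddChar.map_neg_eq_inv]
      congr 2
      field_simp
      ring
    rw [rat_smul_apply, rat_smul_apply, mul_mul_mul_comm, h1, ← hcH]
    exact mul_inv_cancel₀ (hcH w ▸ Circle.coe_ne_zero (w c) : H w ≠ 0)

/-- Applying the relation twice gives invariance under `(a₃ / a₂) ^ 2`, which is positive even when
the coefficients have opposite signs. -/
lemma eq_one_of_mul_smul_eq_one {k : AddChar ℚ Circle → ℂ} (hc : Continuous k) (h0 : k 0 = 1)
    {a₂ a₃ : ℚ} (ha₂ : a₂ ≠ 0) (ha₃ : a₃ ≠ 0) (hcond : |a₂| ≠ |a₃| ∨ a₂ = a₃)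
    (h : ∀ w, k (a₂ • w) * k (a₃ • w) = 1) (y : AddChar ℚ Circle) : k y = 1 := by
  have hr : ∀ w, k w * k ((a₃ / a₂) • w) = 1 := fun w => by
    have h1 := h (a₂⁻¹ • w)
    rwa [smul_smul, smul_smul, mul_inv_cancel₀ ha₂, one_smul, ← div_eq_mul_inv] at h1
  rcases hcond with hcond | rfl
  · have hs : 0 < (a₃ / a₂) ^ 2 := by positivity
    have hs1 : (a₃ / a₂) ^ 2 ≠ 1 := by
      rw [div_pow, Ne, div_eq_one_iff_eq (pow_ne_zero 2 ha₂), sq_eq_sq_iff_abs_eq_abs]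
      exact hcond.symm
    rw [eq_of_forall_smul_eq hc hs hs1 (fun y => ?_) y, h0]
    have h1 := hr y
    have h2 := hr ((a₃ / a₂) • y)
    rw [smul_smul, ← sq] at h2
    linear_combination (-k ((a₃ / a₂) ^ 2 • y)) * h1 + k y * h2
  · refine eq_one_of_sq_eq_one_of_continuous hc h0 (fun y => ?_) y
    have h1 := hr y
    rwa [div_self ha₂, one_smul, ← sq] at h1

end AddChar

theorem theorem4p3 {Ω Ω' : Type*} [MeasurableSpace Ω] [MeasurableSpace Ω']
    (P : Measure Ω) [IsProbabilityMeasure P] (P' : Measure Ω') [IsProbabilityMeasure P']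
    (a₂ a₃ b₂ b₃ : ℚ) (ha₂ : a₂ ≠ 0) (ha₃ : a₃ ≠ 0) (hb₂ : b₂ ≠ 0) (hb₃ : b₃ ≠ 0)
    (ξ : Fin 4 → Ω → ℚ) (η : Fin 4 → Ω' → ℚ)
    (hξ : IsIndepNonvanishing P ξ) (hη : IsIndepNonvanishing P' η)
    (hcond : a₂ * b₃ ≠ a₃ * b₂ ∨
      (a₂ * b₃ = a₃ * b₂ ∧ |a₂| ≠ |a₃| ∧
        IdentDistrib (ξ 1) (ξ 2) P P ∧ IdentDistrib (η 1) (η 2) P' P') ∨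
      (a₂ * b₃ = a₃ * b₂ ∧ a₂ = a₃ ∧
        IdentDistrib (ξ 1) (ξ 2) P P ∧ IdentDistrib (η 1) (η 2) P' P'))
    (hlaw : P.map (linearForms a₂ a₃ b₂ b₃ ξ) = P'.map (linearForms a₂ a₃ b₂ b₃ η)) :
    ∀ j : Fin 4, ∃ c : ℚ, P'.map (η j) = (P.map (ξ j)).map (fun x => x + c) := by
  have hPξ : ∀ j, IsProbabilityMeasure (P.map (ξ j)) := fun j =>
    Measure.isProbabilityMeasure_map (hξ.measurable j).aemeasurable
  have hPη : ∀ j, IsProbabilityMeasure (P'.map (η j)) := fun j =>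
    Measure.isProbabilityMeasure_map (hη.measurable j).aemeasurable
  let h : Fin 4 → AddChar ℚ Circle → ℂ := fun j y =>
    discreteRatCharFun (P'.map (η j)) y / discreteRatCharFun (P.map (ξ j)) y
  have hc : ∀ j, Continuous (h j) := fun j =>
    (continuous_discreteRatCharFun _).div₀ (continuous_discreteRatCharFun _)
      (hξ.charFun_ne_zero j)
  have hne : ∀ j y, h j y ≠ 0 := fun j y =>
    div_ne_zero (hη.charFun_ne_zero j y) (hξ.charFun_ne_zero j y)
  have h0 : ∀ j, h j 0 = 1 := fun j => by simp [h, discreteRatCharFun_zero]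
  have heq : ∀ u v, ∏ i, h i (![1, a₂, a₃, 0] i • u + ![0, b₂, b₃, 1] i • v) = 1 := by
    intro u v
    simp only [h]
    rw [Finset.prod_div_distrib, ← integral_map_linearForms a₂ a₃ b₂ b₃ hξ,
      ← integral_map_linearForms a₂ a₃ b₂ b₃ hη, hlaw]
    refine div_self ?_
    rw [integral_map_linearForms a₂ a₃ b₂ b₃ hη]
    exact Finset.prod_ne_zero_iff.2 fun i _ => hη.charFun_ne_zero i _
  suffices hchar : ∀ j, ∃ c : ℚ, ∀ y, h j y = y c by
    intro j
    obtain ⟨c, hcj⟩ := hchar j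
    refine ⟨c, eq_map_add_of_discreteRatCharFun_eq _ _ c fun y => ?_⟩
    rw [← hcj y]
    exact (mul_div_cancel₀ _ (hξ.charFun_ne_zero j y)).symm
  by_cases hdet : a₂ * b₃ = a₃ * b₂
  · have hrest : (|a₂| ≠ |a₃| ∨ a₂ = a₃) ∧
        IdentDistrib (ξ 1) (ξ 2) P P ∧ IdentDistrib (η 1) (η 2) P' P' := by
      tauto
    obtain ⟨habs, hid, hid'⟩ := hrest
    -- Both remaining conditions exclude `a₂ = -a₃`, where the character of the common ratio could
    -- not be recovered.
    have hsum : a₂ + a₃ ≠ 0 := by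
      intro hs
      have h1 : a₂ = -a₃ := by linarith
      rcases habs with h2 | h2
      · exact h2 (by rw [h1, abs_neg])
      · exact ha₂ (by linarith)
    have h12 : h 2 = h 1 := by
      ext y
      simp only [h, hid.map_eq, hid'.map_eq]
    have hb₂' : b₂ = a₂ * (b₂ / a₂) := by field_simp
    have hb₃' : b₃ = a₃ * (b₂ / a₂) := by
      field_simp
      linarith
    have heq' : ∀ u v, h 0 u * h 1 (a₂ • (u + (b₂ / a₂) • v)) * h 1 (a₃ • (u + (b₂ / a₂) • v)) *
        h 3 v = 1 := by
      intro u v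
      have h1 := heq u v
      rw [Fin.prod_univ_four, h12] at h1
      rw [smul_add, smul_add, smul_smul, smul_smul, ← hb₂', ← hb₃']
      simpa using h1
    obtain ⟨hc0, hc3, c, hk⟩ := AddChar.exists_eq_ratEval_of_mul_linearForm hsum
      (div_ne_zero hb₂ ha₂) (hc 1) (h0 0) (h0 1) (h0 3) heq'
    have hk1 := AddChar.eq_one_of_mul_smul_eq_one (k := fun y => h 1 y * y (-c))
      ((hc 1).mul (AddChar.ratEval (-c)).continuous) (by simp [h0 1]) ha₂ ha₃ habs hk
    have hc1 : ∃ c : ℚ, ∀ y, h 1 y = y c := by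
      refine ⟨c, fun y => ?_⟩
      have h1 := hk1 y
      simp only [AddChar.map_neg_eq_inv, Circle.coe_inv] at h1
      exact (mul_inv_eq_one₀ (Circle.coe_ne_zero _)).1 h1
    intro j
    fin_cases j
    · exact hc0
    · exact hc1
    · exact h12 ▸ hc1
    · exact hc3
  · refine AddChar.exists_eq_ratEval_of_prod_linearForm ?_ hc hne h0 heq
    have hdet' : a₂ * b₃ - b₂ * a₃ ≠ 0 := fun h => hdet (by linarith)
    have hdet'' : a₃ * b₂ - b₃ * a₂ ≠ 0 := fun h => hdet (by linarith)
    -- Up to sign the determinants are `1`, `a₂`, `a₃`, `b₂`, `b₃` and `a₂ * b₃ - a₃ * b₂`.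
    intro i j hij
    fin_cases i <;> fin_cases j <;> simp_all
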